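/- Let $K$ be a field (for instance an algebraically closed field of characteristic $0$, or $\mathbb R$), let $U$ be a coordinate neighbourhood of a point $o$ on a surface over $K$, with local coordinates $x_1,x_2$ vanishing at $o$, and let $\cdots\to S(k)\to S(k-1)\to\cdots\to S(0)=U$ be the monster (Semple) tower: $\mathcal B(0)=TU$; $S(k+1)=\mathbb P\mathcal B(k)$; a tangent vector of $S(k+1)$ at a point representing a line $\ell$ lies in $\mathcal B(k+1)$ iff the derivative of the projection $S(k+1)\to S(k)$ maps it into $\ell$. For a string $p_1\cdots p_k$ in the alphabet $\{1,2\}$ let $\mathcal C(p_1\cdots p_k)\subset S(k)$ be the chart defined recursively by $\mathcal C(\varnothing)=U$ with active coordinates $x_1,x_2$, and, for $q\in\{1,2\}$ with opposite symbol $\bar q$: $\mathcal C(p_1\cdots p_kq)$ is the set of lines at points of $\mathcal C(p_1\cdots p_k)$ on which $dx_q(p_1\cdots p_k)\ne 0$, with active coordinates $x_q(p_1\cdots p_kq)=x_q(p_1\cdots p_k)$ and $x_{\bar q}(p_1\cdots p_kq)=dx_{\bar q}(p_1\cdots p_k)/dx_q(p_1\cdots p_k)$. The node $N(p_1\cdots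 p_k)$ is the origin of $\mathcal C(p_1\cdots p_k)$, i.e. the unique point over $o$ in this chart at which all coordinates $x_i(p_1\cdots p_j)$, $0\le j\le k$, vanish. For $j\ge 2$ let $I_j=I_j[0]\subset S(j)$ consist of the lines tangent to the fibres of $S(j-1)\to S(j-2)$, and let $I_j[n+1]\subset S(j+n+1)$ consist of the lines generated by vectors of $\mathcal B(j+n)$ tangent to $I_j[n]\subset S(j+n)$. A code word of length $k$ is a word $A_1\cdots A_k$ in the symbols $R$, $V_2,V_3,\dots$ with $A_1=R$ and $A_i\in\{R,V_i,A_{i-1}\}$ for $i\ge 2$. If $n_j$ is the number of occurrences of $V_j$, its intersection locus in $S(k)$ is the intersection, over all $2\le j\le k$ with $n_j\ge 1$, of the inverse images of $I_j[n_j-1]$; it has codimension $n_2+\cdots+n_k$. The stratum of a code word is its intersection locus with all intersection loci (of code words of length $k$) of lower dimension removed. The node word $W(p_1\cdots p_k)$ is the code word of the stratum containing $N(p_1\cdots p_k)$. Theorem. For every $k\ge 0$ and every string $p_1\cdots p_k$ in $\{1,2\}$, the node $N(p_1\cdots p_k)$ lies in the stratum of exactly one code word of length $k$, its node word $W(p_1\cdots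 p_k)$, and this word is obtained from $p_1\cdots p_k$ by the following process: replace the initial block of equal symbols by a block of the same length of the symbol $R$, and replace each succeeding block of equal symbols by a block of the same length of the symbol $V_j$, where $j$ is the position (counted from $1$) at which that block begins. For example, $W(222122112)=RRRV_4V_5V_5V_7V_7V_9$. -/

import Mathlib

open scoped DualNumber

universe u v

/-! ## Infinitesimal coefficient algebras

Throughout, tangent vectors are handled in the algebraic way: a tangent vector to a space `X` at a
point is a point of `X` with values in the dual numbers `K[ε]`, and more generally a tangent vector
at an `R`-valued point of `X` is an `R[ε]`-valued point. Iterating this requires points with values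
in iterated dual numbers `K[ε₁]⋯[εₘ]`; the next structure is a convenient class of coefficient
algebras containing `K` and closed under `R ↦ R[ε]`. -/

/-- A commutative `K`-algebra with an augmentation to `K` whose kernel consists of nilpotent
elements (so: a local `K`-algebra with residue field `K` and nil maximal ideal). -/
structure InfAlg (K : Type u) [Field K] where
  carrier : Type u
  [commRing : CommRing carrier]
  [algebra : Algebra K carrier]
  aug : carrier →ₐ[K] K
  nil : ∀ a : carrier, aug a = 0 → IsNilpotent a

attribute [instance] InfAlg.commRing InfAlg.algebra

namespace InfAlg

variable {K : Type u} [Field K]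

/-- The ground field itself. -/
abbrev ground (K : Type u) [Field K] : InfAlg K where
  carrier := K
  aug := AlgHom.id K K
  nil a h := by
    have h' : a = 0 := h
    rw [h']
    exact IsNilpotent.zero

/-- The dual numbers `R[ε]` over `R`. -/
abbrev dual (R : InfAlg K) : InfAlg K where
  carrier := R.carrier[ε]
  aug := R.aug.comp (TrivSqZeroExt.fstHom K R.carrier R.carrier)
  nil _ h := TrivSqZeroExt.isNilpotent_iff_isNilpotent_fst.2 (R.nil _ h)

/-- Homomorphisms of coefficient algebras. -/
abbrev Hom (R R' : InfAlg K) : Type u := R.carrier →ₐ[K] R'.carrier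

/-- The `K`-algebra homomorphism `R[ε] → R`, `ε ↦ 0`. -/
def pt (R : InfAlg K) : Hom R.dual R :=
  TrivSqZeroExt.fstHom K R.carrier R.carrier

/-- The `K`-algebra homomorphism `R → R[ε]`. -/
def const (R : InfAlg K) : Hom R R.dual :=
  TrivSqZeroExt.inlAlgHom K R.carrier R.carrier

/-- The homomorphism `R[ε] → R'[ε]`, `a + b ε ↦ f a + f b ε`, induced by `f : R → R'`. -/
def dualMap {R R' : InfAlg K} (f : Hom R R') : Hom R.dual R'.dual where
  toFun z := TrivSqZeroExt.inl (f z.fst) + TrivSqZeroExt.inr (f z.snd)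
  map_one' := by ext <;> simp
  map_mul' a b := by ext <;> simp
  map_zero' := by ext <;> simp
  map_add' a b := by ext <;> simp
  commutes' c := by ext <;> simp [TrivSqZeroExt.algebraMap_eq_inl']

/-- The homomorphism `R[ε] → R[ε]`, `a + b ε ↦ a + c b ε`. -/
def scale (R : InfAlg K) (c : R.carrier) : Hom R.dual R.dual where
  toFun z := TrivSqZeroExt.inl z.fst + TrivSqZeroExt.inr (c * z.snd)
  map_one' := by ext <;> simp
  map_mul' a b := by
    ext
    · simp
    · simp
      ring
  map_zero' := by ext <;> simp
  map_add' a b := by ext <;> simp [mul_add]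
  commutes' k := by ext <;> simp [TrivSqZeroExt.algebraMap_eq_inl']

theorem aug_hom {R R' : InfAlg K} (f : Hom R R') (a : R.carrier) : R'.aug (f a) = R.aug a := by
  have h : IsNilpotent (a - algebraMap K R.carrier (R.aug a)) :=
    R.nil _ (by simp)
  have h2 := (h.map f).map R'.aug
  have h3 := h2.eq_zero
  simpa [sub_eq_zero] using h3

theorem aug_comp {R R' : InfAlg K} (f : Hom R R') : R'.aug.comp f = R.aug :=
  AlgHom.ext (aug_hom f)

theorem dualMap_id (R : InfAlg K) :
    dualMap (AlgHom.id K R.carrier : Hom R R) = AlgHom.id K R.dual.carrier := by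
  refine AlgHom.ext fun z => ?_
  ext <;> simp [dualMap]

theorem dualMap_comp {R R' R'' : InfAlg K} (g : Hom R' R'') (f : Hom R R') :
    (dualMap g).comp (dualMap f) = dualMap (g.comp f : Hom R R'') := by
  refine AlgHom.ext fun z => ?_
  ext <;> simp [dualMap]

theorem dualMap_scale {R R' : InfAlg K} (f : Hom R R') (c : R.carrier) :
    (dualMap f).comp (R.scale c) = (R'.scale (f c)).comp (dualMap f) := by
  refine AlgHom.ext fun z => ?_
  ext <;> simp [dualMap, scale]

theorem pt_comp_dualMap {R R' : InfAlg K} (f : Hom R R') :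
    R'.pt.comp (dualMap f) = f.comp R.pt := by
  refine AlgHom.ext fun z => ?_
  simp [dualMap, pt]

theorem pt_comp_scale (R : InfAlg K) (c : R.carrier) : R.pt.comp (R.scale c) = R.pt := by
  refine AlgHom.ext fun z => ?_
  simp [scale, pt]

end InfAlg

/-! ## Spaces with a distribution, and prolongation -/

/-- A space, given by its `R`-valued points for all coefficient algebras `R`, together with a
distribution, i.e. a collection `foc R` of distinguished ("focal") tangent vectors at its `R`-valued
points. A tangent vector at an `R`-valued point is an element `w : obj R.dual`; its foot point is
`map R.pt w`, and its multiple by the scalar `c` is `map (R.scale c) w`. -/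
structure DistSpace (K : Type u) [Field K] where
  obj : InfAlg K → Type v
  map : {R R' : InfAlg K} → InfAlg.Hom R R' → obj R → obj R'
  map_id : ∀ (R : InfAlg K) (x : obj R), map (AlgHom.id K R.carrier : InfAlg.Hom R R) x = x
  map_comp : ∀ {R R' R'' : InfAlg K} (g : InfAlg.Hom R' R'') (f : InfAlg.Hom R R') (x : obj R),
    map g (map f x) = map (g.comp f : InfAlg.Hom R R'') x
  foc : (R : InfAlg K) → Set (obj R.dual)
  foc_map : ∀ {R R' : InfAlg K} (f : InfAlg.Hom R R') (w : obj R.dual),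
    w ∈ foc R → map (InfAlg.dualMap f) w ∈ foc R'

namespace DistSpace

variable {K : Type u} [Field K]

/-- The zero tangent vector at an `R`-valued point. -/
def zeroVec (X : DistSpace.{u, v} K) {R : InfAlg K} (x : X.obj R) : X.obj R.dual :=
  X.map R.const x

/-- The foot point of a tangent vector. -/
def foot (X : DistSpace.{u, v} K) {R : InfAlg K} (w : X.obj R.dual) : X.obj R :=
  X.map R.pt w

/-- The multiple of a tangent vector by a scalar. -/
def smul (X : DistSpace.{u, v} K) {R : InfAlg K} (c : R.carrier) (w : X.obj R.dual) :
    X.obj R.dual :=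
  X.map (R.scale c) w

/-- The reduction of an `R`-valued point to a `K`-valued point. -/
def red (X : DistSpace.{u, v} K) {R : InfAlg K} (x : X.obj R) : X.obj (InfAlg.ground K) :=
  X.map (R.aug : InfAlg.Hom R (InfAlg.ground K)) x

/-- The reduction of a tangent vector at an `R`-valued point to a tangent vector at a `K`-valued
point. -/
def redVec (X : DistSpace.{u, v} K) {R : InfAlg K} (w : X.obj R.dual) :
    X.obj (InfAlg.ground K).dual :=
  X.map (InfAlg.dualMap (R.aug : InfAlg.Hom R (InfAlg.ground K))) w

/-- Focal vectors at `R`-valued points which generate a line, i.e. whose reduction to the residue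
field `K` is not a zero vector. -/
def Dir (X : DistSpace.{u, v} K) (R : InfAlg K) : Type v :=
  {w : X.obj R.dual // w ∈ X.foc R ∧ X.redVec w ≠ X.zeroVec (X.foot (X.redVec w))}

/-- Two vectors generate the same line if they differ by multiplication with a unit. -/
def SameLine (X : DistSpace.{u, v} K) (R : InfAlg K) (w w' : X.Dir R) : Prop :=
  ∃ a : R.carrierˣ, w'.1 = X.smul (a : R.carrier) w.1

/-- The `R`-valued points of the projectivization of the distribution of `X`. For `R = K` these
are the pairs of a point `x` of `X` and a line in the distribution at `x`. -/
def Lines (X : DistSpace.{u, v} K) (R : InfAlg K) : Type v := Quot (X.SameLine R)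

/-- The line generated by a vector. -/
def line (X : DistSpace.{u, v} K) {R : InfAlg K} (w : X.Dir R) : X.Lines R := Quot.mk _ w

theorem map_congr (X : DistSpace.{u, v} K) {R R' : InfAlg K} {f g : InfAlg.Hom R R'} (h : f = g)
    (x : X.obj R) : X.map f x = X.map g x := by rw [h]

theorem redVec_map (X : DistSpace.{u, v} K) {R R' : InfAlg K} (f : InfAlg.Hom R R')
    (w : X.obj R.dual) : X.redVec (X.map (InfAlg.dualMap f) w) = X.redVec w := by
  unfold redVec
  rw [X.map_comp]
  refine X.map_congr ?_ w
  refine (InfAlg.dualMap_comp _ _).trans ?_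
  congr 1
  exact InfAlg.aug_comp f

theorem foot_map (X : DistSpace.{u, v} K) {R R' : InfAlg K} (f : InfAlg.Hom R R')
    (w : X.obj R.dual) : X.foot (X.map (InfAlg.dualMap f) w) = X.map f (X.foot w) := by
  unfold foot
  rw [X.map_comp, X.map_comp, InfAlg.pt_comp_dualMap]

theorem smul_map (X : DistSpace.{u, v} K) {R R' : InfAlg K} (f : InfAlg.Hom R R')
    (c : R.carrier) (w : X.obj R.dual) :
    X.map (InfAlg.dualMap f) (X.smul c w) = X.smul (f c) (X.map (InfAlg.dualMap f) w) := by
  unfold smul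
  rw [X.map_comp, X.map_comp, InfAlg.dualMap_scale]

theorem foot_smul (X : DistSpace.{u, v} K) {R : InfAlg K} (c : R.carrier) (w : X.obj R.dual) :
    X.foot (X.smul c w) = X.foot w := by
  unfold foot smul
  rw [X.map_comp, InfAlg.pt_comp_scale]

/-- Functoriality of `Dir`. -/
def dirMap (X : DistSpace.{u, v} K) {R R' : InfAlg K} (f : InfAlg.Hom R R') (w : X.Dir R) :
    X.Dir R' :=
  ⟨X.map (InfAlg.dualMap f) w.1, X.foc_map f _ w.2.1, by
    rw [X.redVec_map]
    exact w.2.2⟩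

/-- Functoriality of `Lines`. -/
def linesMap (X : DistSpace.{u, v} K) {R R' : InfAlg K} (f : InfAlg.Hom R R') :
    X.Lines R → X.Lines R' :=
  Quot.map (X.dirMap f) (by
    rintro w w' ⟨a, ha⟩
    refine ⟨Units.map (f : R.carrier →* R'.carrier) a, ?_⟩
    change X.map (InfAlg.dualMap f) w'.1 = _
    rw [ha, X.smul_map]
    rfl)

/-- The projection `π` from the projectivization to `X`. -/
def linesProj (X : DistSpace.{u, v} K) {R : InfAlg K} : X.Lines R → X.obj R :=
  Quot.lift (fun w => X.foot w.1) (by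
    rintro w w' ⟨a, ha⟩
    rw [ha, X.foot_smul])

theorem linesProj_map (X : DistSpace.{u, v} K) {R R' : InfAlg K} (f : InfAlg.Hom R R')
    (x : X.Lines R) : X.linesProj (X.linesMap f x) = X.map f (X.linesProj x) := by
  induction x using Quot.ind with
  | mk w => exact X.foot_map f w.1

theorem linesMap_comp (X : DistSpace.{u, v} K) {R R' R'' : InfAlg K} (g : InfAlg.Hom R' R'')
    (f : InfAlg.Hom R R') (x : X.Lines R) :
    X.linesMap g (X.linesMap f x) = X.linesMap (g.comp f : InfAlg.Hom R R'') x := by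
  induction x using Quot.ind with
  | mk w =>
    refine congrArg (Quot.mk _) (Subtype.ext ?_)
    change X.map (InfAlg.dualMap g) (X.map (InfAlg.dualMap f) w.1) = X.map _ w.1
    rw [X.map_comp, InfAlg.dualMap_comp]

/-- The prolongation of a space with a distribution: its points are the lines in the distribution,
and a tangent vector `v` at a line `ℓ` is focal if and only if the derivative of the projection `π`
maps it to a vector lying in the line `ℓ` (zero included). -/
def prolong (X : DistSpace.{u, v} K) : DistSpace.{u, v} K where
  obj := X.Lines
  map := X.linesMap
  map_id R x := by
    induction x using Quot.ind with
    | mk w =>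
      refine congrArg (Quot.mk _) (Subtype.ext ?_)
      change X.map (InfAlg.dualMap (AlgHom.id K R.carrier : InfAlg.Hom R R)) w.1 = w.1
      rw [InfAlg.dualMap_id]
      exact X.map_id _ _
  map_comp := X.linesMap_comp
  foc R := {v | ∃ (w : X.Dir R) (c : R.carrier),
    X.linesMap R.pt v = X.line w ∧ X.linesProj v = X.smul c w.1}
  foc_map := by
    rintro R R' f v ⟨w, c, h1, h2⟩
    refine ⟨X.dirMap f w, f c, ?_, ?_⟩
    · have h := congrArg (X.linesMap f) h1
      rw [X.linesMap_comp] at h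
      rw [X.linesMap_comp, InfAlg.pt_comp_dualMap]
      exact h
    · rw [X.linesProj_map, h2, X.smul_map]
      rfl

/-- The projection `π` from the prolongation. -/
def proj (X : DistSpace.{u, v} K) {R : InfAlg K} (x : X.prolong.obj R) : X.obj R := X.linesProj x

/-- A subspace, given by its `R`-valued points. -/
abbrev Locus (X : DistSpace.{u, v} K) : Type (max (u + 1) v) := (R : InfAlg K) → Set (X.obj R)

/-- The prolongation of a subspace `Z` of `X`: all lines generated by focal vectors tangent
to `Z`. -/
def Locus.prolong {X : DistSpace.{u, v} K} (Z : X.Locus) : X.prolong.Locus :=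
  fun R => {x | ∃ w : X.Dir R, w.1 ∈ Z R.dual ∧ x = X.line w}

/-- A tangent vector of the prolongation is vertical if the derivative of `π` kills it. -/
def IsVertical (X : DistSpace.{u, v} K) {R : InfAlg K} (w : X.prolong.obj R.dual) : Prop :=
  X.proj w = X.zeroVec (X.foot (X.proj w))

/-- The divisor at infinity in the second prolongation of `X`: all lines generated by vertical
vectors of the first prolongation. -/
def atInfinity (X : DistSpace.{u, v} K) : X.prolong.prolong.Locus :=
  fun R => {x | ∃ w : X.prolong.Dir R, X.IsVertical w.1 ∧ x = X.prolong.line w}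

end DistSpace

/-! ## The monster tower over a coordinate neighbourhood -/

/-- The two symbols `1` and `2`. -/
inductive Letter
  | one
  | two
  deriving DecidableEq

/-- The opposite symbol. -/
def Letter.bar : Letter → Letter
  | .one => .two
  | .two => .one

/-- A coordinate neighbourhood `U` on a surface, with local coordinates `x₁, x₂ : U → K` (étale
coordinates on a variety, or a chart of a manifold), and with all tangent vectors as distribution.
An `R`-valued point is a point of `U` together with an infinitesimal displacement, i.e. with values
in `R` of the two coordinate functions which reduce to their values in `K` at this point; that such
values determine a unique `R`-valued point is what it means that `x₁, x₂` are local coordinates.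
In particular the tangent space at each point is `K²`, with coordinates `dx₁, dx₂`. -/
def coordSurface {K : Type u} [Field K] {U : Type v} (x : Letter → U → K) :
    DistSpace.{u, max u v} K where
  obj R := {b : U × (Letter → R.carrier) // ∀ i, R.aug (b.2 i) = x i b.1}
  map f b := ⟨(b.1.1, fun i => f (b.1.2 i)), fun i => by
    rw [InfAlg.aug_hom]
    exact b.2 i⟩
  map_id _ _ := rfl
  map_comp _ _ _ := rfl
  foc _ := Set.univ
  foc_map _ _ _ := trivial

section Monster

variable {K : Type u} [Field K] {U : Type v} (x : Letter → U → K)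

/-- The monster tower `S(k)` over the coordinate neighbourhood. -/
def monster : ℕ → DistSpace.{u, max u v} K
  | 0 => coordSurface x
  | k + 1 => (monster k).prolong

/-- The points of the monster space `S(k)`. -/
abbrev MonsterPt (k : ℕ) : Type (max u v) := (monster x k).obj (InfAlg.ground K)

/-- The projection `S(k) → S(l)` for `l ≤ k`. -/
def truncPt {l k : ℕ} (h : l ≤ k) (y : MonsterPt x k) : MonsterPt x l :=
  Nat.leRec (motive := fun k _ => MonsterPt x k → MonsterPt x l) (fun y => y)
    (fun k _ f y => f ((monster x k).proj y)) h y

/-! ### Charts -/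

/-- `IsActive x p y X` says that the `R`-valued point `y` of `S(k)` lies in the chart
`C(p₁⋯pₖ)`, and that its active coordinates in this chart are `X i = x_i(p₁⋯pₖ)`. For `k = 0` these
are the coordinates on `U`. A line generated by a focal vector `w` at a point of
`C(p₁⋯pₖ)` belongs to the chart `C(p₁⋯pₖ q)` if the differential `d x_q(p₁⋯pₖ)` does not
vanish on it, and then
`x_q(p₁⋯pₖ q) = x_q(p₁⋯pₖ)`, `x_q̄(p₁⋯pₖ q) = d x_q̄(p₁⋯pₖ) / d x_q(p₁⋯pₖ)`.
The values of the differentials on `w` are the `ε`-parts of the coordinates of the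
`R[ε]`-valued point `w`. -/
def IsActive : (k : ℕ) → (p : Fin k → Letter) → {R : InfAlg K} → (monster x k).obj R →
    (Letter → R.carrier) → Prop
  | 0, _, _, y, X => X = (show (coordSurface x).obj _ from y).1.2
  | k + 1, p, R, y, X => ∃ (w : (monster x k).Dir R) (Y : Letter → R.dual.carrier),
      y = (monster x k).line w ∧
      IsActive k (fun i => p i.castSucc) (R := R.dual) w.1 Y ∧
      IsUnit (TrivSqZeroExt.snd (Y (p (Fin.last k)))) ∧
      X (p (Fin.last k)) = TrivSqZeroExt.fst (Y (p (Fin.last k))) ∧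
      X (p (Fin.last k)).bar * TrivSqZeroExt.snd (Y (p (Fin.last k))) =
        TrivSqZeroExt.snd (Y (p (Fin.last k)).bar)

/-- `IsNode x o p y` says that `y` is the origin `N(p₁⋯pₖ)` of the chart `C(p₁⋯pₖ)`: it lies over
the point `o` of `U` (the point with `x₁ = x₂ = 0` under consideration) and all coordinates
`x_i(p₁⋯pⱼ)`, `j ≤ k`, vanish at it. -/
def IsNode (o : U) : (k : ℕ) → (p : Fin k → Letter) → MonsterPt x k → Prop
  | 0, p, y => (show (coordSurface x).obj _ from y).1.1 = o ∧ IsActive x 0 p y (fun _ => 0)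
  | k + 1, p, y => IsNode o k (fun i => p i.castSucc) ((monster x k).proj y) ∧
      IsActive x (k + 1) p y (fun _ => 0)

/-! ### Divisors at infinity, code words and strata -/

/-- The subspace `I_{m+2}[n]` of `S(m+2+n)`: the divisor at infinity `I_{m+2}` of `S(m+2)` for
`n = 0`, and its successive prolongations. -/
def infDivisor (m : ℕ) : (n : ℕ) → (monster x (m + 2 + n)).Locus
  | 0 => (monster x m).atInfinity
  | n + 1 => (infDivisor m n).prolong

end Monster

/-- The symbols of code words: `R` (also written `V_∅`), and `V_j`. -/
inductive CodeSymbol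
  | R
  | V (j : ℕ)
  deriving DecidableEq

/-- Code words `A₁⋯Aₖ`: the first symbol is `R`, and for `j ≥ 2` the `j`-th symbol is `R`, or `V_j`,
or equal to the prior symbol. (The `j`-th symbol is `A i` with `j = i + 1`.) -/
def IsCodeWord {k : ℕ} (A : Fin k → CodeSymbol) : Prop :=
  (∀ i : Fin k, (i : ℕ) = 0 → A i = .R) ∧
  ∀ i i' : Fin k, (i' : ℕ) = i + 1 → A i' = .R ∨ A i' = .V (i' + 1) ∨ A i' = A i

/-- The number `n_j` of occurrences of `V_j` in a word. -/
def numV {k : ℕ} (A : Fin k → CodeSymbol) (j : ℕ) : ℕ :=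
  (Finset.univ.filter fun i => A i = .V j).card

/-- The number `n₂ + ⋯ + nₖ`, the codimension of the intersection locus of `A`. -/
def codim {k : ℕ} (A : Fin k → CodeSymbol) : ℕ := ∑ j ∈ Finset.Icc 2 k, numV A j

section Strata

variable {K : Type u} [Field K] {U : Type v} (x : Letter → U → K)

/-- The intersection locus `I_A = ⋂_j I_j[n_j - 1]` in `S(k)`, where `j` runs through `2, …, k`,
where `I_j[n_j - 1]`, for `n_j ≥ 1`, is replaced by its full inverse image in `S(k)`, and where the
factors with `n_j = 0` are omitted. (Here `j = m + 2` and `n_j = n + 1`.) -/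
def interLocus {k : ℕ} (A : Fin k → CodeSymbol) : Set (MonsterPt x k) :=
  {y | ∀ (m n : ℕ) (h : m + 2 + n ≤ k), numV A (m + 2) = n + 1 →
    truncPt x h y ∈ infDivisor x m n (InfAlg.ground K)}

/-- The stratum of a code word: its intersection locus with all intersection loci of lower
dimension removed. -/
def stratum {k : ℕ} (A : Fin k → CodeSymbol) : Set (MonsterPt x k) :=
  {y | y ∈ interLocus x A ∧
    ∀ A' : Fin k → CodeSymbol, IsCodeWord A' → codim A < codim A' → y ∉ interLocus x A'}

/-- `A` is the node word `W(p₁⋯pₖ)`: the code word of the stratum that contains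
the node `N(p₁⋯pₖ)`. -/
def IsNodeWord (o : U) {k : ℕ} (p : Fin k → Letter) (A : Fin k → CodeSymbol) : Prop :=
  IsCodeWord A ∧ ∃ y : MonsterPt x k, IsNode x o k p y ∧ y ∈ stratum x A

end Strata

/-! ## The block rule -/

/-- The position (counted from `1`) at which the block of equal symbols containing the symbol
with index `i` (position `i + 1`) begins. -/
noncomputable def blockBegin {k : ℕ} (p : Fin k → Letter) (i : Fin k) : ℕ :=
  sInf {j : ℕ | 1 ≤ j ∧ j ≤ (i : ℕ) + 1 ∧
    ∀ l : Fin k, j ≤ (l : ℕ) + 1 → (l : ℕ) ≤ i → p l = p i}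

/-- Replace each symbol of the initial block by `R`, and each symbol of a later block by `V_j`,
where `j` is the position at which that block begins. -/
noncomputable def blockWord {k : ℕ} (p : Fin k → Letter) (i : Fin k) : CodeSymbol :=
  if blockBegin p i = 1 then .R else .V (blockBegin p i)

/-! In every chart the distribution has rank two: a focal vector at a given point is determined by
the differentials of the two active coordinates, and these can be prescribed freely. `IsChart`
records this, and `IsChart.prolong` carries it up the tower.

Such a chart yields local equations. A focal vector of the prolongation in the chart named `q` is
vertical exactly when the retained coordinate has `dx_q = 0`. Lines on which `dx_q` vanishes lie
only in the chart of the opposite letter, where the equation reads `x_q = 0` (`mem_atInfinity_iff`).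
Prolonging a locus on which `x_q = 0` again forces the letter opposite to `q` and again `x_q = 0`.
All active coordinates vanish at a node, so it lies on the `n`-th prolongation of a divisor at
infinity iff a block begins at the position of that divisor and has length at least `n + 1`
(`IsNode.mem_infDivisor_iff`).

The rest is combinatorial. The node lies in the intersection locus of its block word. If it also
lies in that of a code word `A`, each symbol of `A` is `R` or agrees with the block word
(`IsNode.eq_R_or_eq_blockWord`). As the codimension counts the symbols other than `R`, the block
word alone attains the maximum, and so names the only stratum containing the node. -/

namespace InfAlg

variable {K : Type u} [Field K]

theorem scale_comp_scale (R : InfAlg K) (c d : R.carrier) :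
    (R.scale c).comp (R.scale d) = R.scale (c * d) := by
  refine AlgHom.ext fun z => TrivSqZeroExt.ext ?_ ?_
  · simp [scale]
  · simp [scale, mul_assoc]

theorem scale_one (R : InfAlg K) : R.scale 1 = AlgHom.id K R.dual.carrier := by
  refine AlgHom.ext fun z => TrivSqZeroExt.ext ?_ ?_ <;> simp [scale]

theorem scale_zero (R : InfAlg K) : R.scale 0 = R.const.comp R.pt := by
  refine AlgHom.ext fun z => TrivSqZeroExt.ext ?_ ?_ <;> simp [scale, const, pt]

end InfAlg

namespace Letter

@[simp] theorem bar_bar (q : Letter) : q.bar.bar = q := by cases q <;> rfl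

@[simp] theorem bar_ne (q : Letter) : q.bar ≠ q := by cases q <;> simp [bar]

theorem eq_or_eq_bar (q i : Letter) : i = q ∨ i = q.bar := by
  cases q <;> cases i <;> simp [bar]

theorem eq_bar_of_ne {q i : Letter} (h : i ≠ q) : i = q.bar := (eq_or_eq_bar q i).resolve_left h

end Letter

/-! ### Scalar multiples and lines. -/

namespace DistSpace

variable {K : Type u} [Field K] {X : DistSpace.{u, v} K}

theorem smul_smul {R : InfAlg K} (c d : R.carrier) (w : X.obj R.dual) :
    X.smul c (X.smul d w) = X.smul (c * d) w := by
  unfold smul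
  rw [X.map_comp, InfAlg.scale_comp_scale]

theorem one_smul {R : InfAlg K} (w : X.obj R.dual) : X.smul 1 w = w := by
  unfold smul
  rw [InfAlg.scale_one]
  exact X.map_id _ _

theorem zero_smul {R : InfAlg K} (w : X.obj R.dual) : X.smul 0 w = X.zeroVec (X.foot w) := by
  unfold smul zeroVec foot
  rw [X.map_comp, InfAlg.scale_zero]

theorem foot_zeroVec {R : InfAlg K} (y : X.obj R) : X.foot (X.zeroVec y) = y := by
  unfold foot zeroVec
  rw [X.map_comp]
  exact X.map_id _ _

theorem line_eq_line_iff {R : InfAlg K} {w w' : X.Dir R} :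
    X.line w = X.line w' ↔ ∃ a : R.carrierˣ, w'.1 = X.smul (a : R.carrier) w.1 := by
  have hE : Equivalence (X.SameLine R) := by
    refine ⟨fun w => ⟨1, by simp [one_smul]⟩, ?_, ?_⟩
    · rintro w w' ⟨a, ha⟩
      exact ⟨a⁻¹, by rw [ha, smul_smul]; simp [one_smul]⟩
    · rintro w w' w'' ⟨a, ha⟩ ⟨b, hb⟩
      exact ⟨b * a, by rw [hb, ha, smul_smul]; simp⟩
  exact ⟨fun h => (Equivalence.eqvGen_iff hE).1 (Quot.eqvGen_exact h), fun h => Quot.sound h⟩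

/-- The distribution is stable under scalar multiplication. -/
def SMulClosed (X : DistSpace.{u, v} K) : Prop :=
  ∀ {R : InfAlg K} (c : R.carrier) (w : X.obj R.dual), w ∈ X.foc R → X.smul c w ∈ X.foc R

theorem SMulClosed.prolong (X : DistSpace.{u, v} K) : X.prolong.SMulClosed := by
  rintro R c w ⟨v, d, h1, h2⟩
  refine ⟨v, c * d, ?_, ?_⟩
  · rw [← h1]
    exact X.prolong.foot_smul c w
  · rw [← smul_smul, ← h2]
    exact X.linesProj_map _ w

/-- A scalar multiple by a unit of a vector which generates a line. -/
def Dir.unitSMul (hX : X.SMulClosed) {R : InfAlg K} (a : R.carrierˣ) (w : X.Dir R) : X.Dir R :=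
  ⟨X.smul (a : R.carrier) w.1, hX _ _ w.2.1, by
    intro h
    have hr : ∀ c : R.carrier, X.redVec (X.smul c w.1) = X.smul (R.aug c) (X.redVec w.1) :=
      fun c => X.smul_map (R' := InfAlg.ground K) R.aug c w.1
    rw [hr, X.foot_smul] at h
    have ha : R.aug (a : R.carrier) ≠ 0 := (a.isUnit.map R.aug).ne_zero
    have h' := congrArg (X.smul (R := InfAlg.ground K) (R.aug (a : R.carrier))⁻¹) h
    rw [smul_smul, inv_mul_cancel₀ ha, one_smul, ← zero_smul, smul_smul, mul_zero,
      zero_smul] at h'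
    exact w.2.2 h'⟩

theorem line_unitSMul (hX : X.SMulClosed) {R : InfAlg K} (a : R.carrierˣ) (w : X.Dir R) :
    X.line (w.unitSMul hX a) = X.line w :=
  (line_eq_line_iff.2 ⟨a, rfl⟩).symm

/-! ### Charts with two active coordinates, and their prolongation. -/

/-- `act y c` expresses that the points `y` of an open subspace of `X` have the active coordinates
`c`: these are functorial, and focal vectors at such a point have unique and arbitrary
differentials of the active coordinates. -/
structure IsChart (X : DistSpace.{u, v} K)
    (act : {R : InfAlg K} → X.obj R → (Letter → R.carrier) → Prop) : Prop where
  smulClosed : X.SMulClosed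
  map : ∀ {R R' : InfAlg K} (f : InfAlg.Hom R R') {y : X.obj R} {c : Letter → R.carrier},
    act y c → act (X.map f y) (fun i => f (c i))
  unique : ∀ {R : InfAlg K} {y : X.obj R} {c c' : Letter → R.carrier}, act y c → act y c' → c = c'
  lift : ∀ {R : InfAlg K} {y : X.obj R} {c : Letter → R.carrier}, act y c →
    ∀ C : Letter → R.dual.carrier, (∀ i, TrivSqZeroExt.fst (C i) = c i) →
      ∃ w ∈ X.foc R, X.foot w = y ∧ act w C
  ext : ∀ {R : InfAlg K} {w w' : X.obj R.dual} {C : Letter → R.dual.carrier},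
    w ∈ X.foc R → w' ∈ X.foc R → X.foot w = X.foot w' → act w C → act w' C → w = w'

/-- The chart of the prolongation consisting of the lines on which the differential of the `q`-th
active coordinate does not vanish. -/
def prolongAct (act : {R : InfAlg K} → X.obj R → (Letter → R.carrier) → Prop) (q : Letter)
    {R : InfAlg K} (y : X.prolong.obj R) (c : Letter → R.carrier) : Prop :=
  ∃ (w : X.Dir R) (Y : Letter → R.dual.carrier), y = X.line w ∧ act (R := R.dual) w.1 Y ∧
    IsUnit (TrivSqZeroExt.snd (Y q)) ∧ c q = TrivSqZeroExt.fst (Y q) ∧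
    c q.bar * TrivSqZeroExt.snd (Y q) = TrivSqZeroExt.snd (Y q.bar)

namespace IsChart

variable {act : {R : InfAlg K} → X.obj R → (Letter → R.carrier) → Prop} (hc : X.IsChart act)
include hc

theorem act_smul {R : InfAlg K} {w : X.obj R.dual} {Y : Letter → R.dual.carrier}
    (h : act w Y) (a : R.carrier) : act (R := R.dual) (X.smul a w) (fun i => R.scale a (Y i)) :=
  hc.map (R.scale a) h

theorem act_foot {R : InfAlg K} {w : X.obj R.dual} {Y : Letter → R.dual.carrier}
    (h : act w Y) : act (X.foot w) (fun i => TrivSqZeroExt.fst (Y i)) :=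
  hc.map R.pt h

/-- A zero vector is fixed by scaling with `0`, which kills the `ε`-parts; uniqueness of the
coordinates does the rest. -/
theorem snd_eq_zero_of_eq_zeroVec {R : InfAlg K} {w : X.obj R.dual} {y : X.obj R}
    {Y : Letter → R.dual.carrier} (h : act w Y) (hw : w = X.zeroVec y) (i : Letter) :
    TrivSqZeroExt.snd (Y i) = 0 := by
  have h1 : act (R := R.dual) w (fun i => R.scale 0 (Y i)) := by
    have h2 := hc.act_smul h 0
    rwa [zero_smul, hw, foot_zeroVec, ← hw] at h2
  have h3 := congrArg TrivSqZeroExt.snd (congrFun (hc.unique h h1) i)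
  simpa [InfAlg.scale] using h3

theorem redVec_ne {R : InfAlg K} {w : X.obj R.dual} {Y : Letter → R.dual.carrier} (h : act w Y)
    {q : Letter} (hq : IsUnit (TrivSqZeroExt.snd (Y q))) :
    X.redVec w ≠ X.zeroVec (X.foot (X.redVec w)) := by
  intro h0
  have h1 := hc.snd_eq_zero_of_eq_zeroVec
    (hc.map (InfAlg.dualMap (R' := InfAlg.ground K) R.aug) h) h0 q
  refine (hq.map R.aug).ne_zero (Eq.trans ?_ h1)
  simp [InfAlg.dualMap]

theorem of_line {q : Letter} {R : InfAlg K} {w : X.Dir R} {c : Letter → R.carrier}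
    (h : prolongAct act q (X.line w : X.prolong.obj R) c) :
    ∃ Y : Letter → R.dual.carrier, act (R := R.dual) w.1 Y ∧
      IsUnit (TrivSqZeroExt.snd (Y q)) ∧ c q = TrivSqZeroExt.fst (Y q) ∧
      c q.bar * TrivSqZeroExt.snd (Y q) = TrivSqZeroExt.snd (Y q.bar) := by
  obtain ⟨w', Y, h1, h2, h3, h4, h5⟩ := h
  obtain ⟨a, ha⟩ := line_eq_line_iff.1 h1.symm
  refine ⟨fun i => R.scale (a : R.carrier) (Y i), ?_, ?_, ?_, ?_⟩
  · rw [ha]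
    exact hc.act_smul h2 _
  · simpa [InfAlg.scale] using h3
  · simpa [InfAlg.scale] using h4
  · simp [InfAlg.scale, ← h5, mul_left_comm]

/-- Dividing a generator by the unit `dx_q` makes its differentials `1` and `c q.bar`, so the
coordinates of the line can be read off directly. -/
theorem normalForm {q : Letter} {R : InfAlg K} {y : X.prolong.obj R} {c : Letter → R.carrier}
    (h : prolongAct act q y c) :
    ∃ (w : X.Dir R) (Y : Letter → R.dual.carrier), y = X.line w ∧ act (R := R.dual) w.1 Y ∧
      TrivSqZeroExt.fst (Y q) = c q ∧ TrivSqZeroExt.snd (Y q) = 1 ∧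
      TrivSqZeroExt.snd (Y q.bar) = c q.bar := by
  obtain ⟨w, Y, h1, h2, ⟨a, ha⟩, h4, h5⟩ := h
  refine ⟨w.unitSMul hc.smulClosed a⁻¹, fun i => R.scale ((a⁻¹ : R.carrierˣ) : R.carrier) (Y i),
    ?_, hc.act_smul h2 _, ?_, ?_, ?_⟩
  · rw [line_unitSMul, h1]
  · simpa [InfAlg.scale] using h4.symm
  · simp [InfAlg.scale, ← ha]
  · simp [InfAlg.scale, ← ha, ← h5, mul_comm]

theorem prolong_map (q : Letter) {R R' : InfAlg K} (f : InfAlg.Hom R R') {y : X.prolong.obj R}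
    {c : Letter → R.carrier} (h : prolongAct act q y c) :
    prolongAct act q (X.prolong.map f y) (fun i => f (c i)) := by
  obtain ⟨w, Y, rfl, h2, h3, h4, h5⟩ := h
  refine ⟨X.dirMap f w, _, rfl, hc.map (InfAlg.dualMap f) h2, ?_, ?_, ?_⟩
  · simpa [InfAlg.dualMap] using h3.map f
  · simp [InfAlg.dualMap, h4]
  · simp [InfAlg.dualMap, ← h5]

theorem prolong_unique (q : Letter) {R : InfAlg K} {y : X.prolong.obj R} {c c' : Letter → R.carrier}
    (h : prolongAct act q y c) (h' : prolongAct act q y c') : c = c' := by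
  obtain ⟨w, Y, rfl, h2, h3, h4, h5⟩ := h
  obtain ⟨Y', h2', -, h4', h5'⟩ := hc.of_line h'
  obtain rfl := hc.unique h2 h2'
  funext i
  rcases Letter.eq_or_eq_bar q i with rfl | rfl
  · rw [h4, h4']
  · exact h3.mul_right_cancel (h5.trans h5'.symm)

theorem prolong_lift (q : Letter) {R : InfAlg K} {y : X.prolong.obj R} {c : Letter → R.carrier}
    (h : prolongAct act q y c) (C : Letter → R.dual.carrier)
    (hC : ∀ i, TrivSqZeroExt.fst (C i) = c i) :
    ∃ w ∈ X.prolong.foc R, X.prolong.foot w = y ∧ prolongAct act q (R := R.dual) w C := by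
  obtain ⟨w, Y, rfl, h2, h3, h4, h5⟩ := hc.normalForm h
  have hs := hc.act_smul h2 (TrivSqZeroExt.snd (C q))
  -- A tangent vector of the prolongation is a line over `R[ε]`. Focality forces its foot to be a
  -- multiple of `w`, and `dx_q(w) = 1` makes the factor the `ε`-part of `C q`. The generator of the
  -- moved line is taken in normal form: differentials `1` and `C q.bar`.
  let D : Letter → R.dual.dual.carrier := fun i =>
    ((R.scale (TrivSqZeroExt.snd (C q)) (Y i), if i = q then 1 else C i) :
      R.dual.carrier × R.dual.carrier)
  have hDf : ∀ i, TrivSqZeroExt.fst (D i) = R.scale (TrivSqZeroExt.snd (C q)) (Y i) := fun _ => rfl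
  have hDs : ∀ i, TrivSqZeroExt.snd (D i) = if i = q then 1 else C i := fun _ => rfl
  obtain ⟨v, v1, v2, v3⟩ := hc.lift (R := R.dual) hs D hDf
  have hu : IsUnit (TrivSqZeroExt.snd (D q)) := by simp [hDs]
  let V : X.Dir R.dual := ⟨v, v1, hc.redVec_ne v3 hu⟩
  -- Setting the `ε` of the displacement to zero must give back the original generator; this is
  -- compared in coordinates.
  have hV : X.dirMap R.pt V = w := by
    refine Subtype.ext (hc.ext (X.dirMap R.pt V).2.1 w.2.1 ?_
      (hc.map (InfAlg.dualMap R.pt) v3) ?_)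
    · refine (X.foot_map R.pt v).trans ?_
      rw [v2]
      exact X.foot_smul _ _
    · convert h2 using 1
      funext i
      have e1 : ∀ z : R.dual.dual.carrier, TrivSqZeroExt.fst (InfAlg.dualMap R.pt z) =
          TrivSqZeroExt.fst (TrivSqZeroExt.fst z) := fun z => by simp [InfAlg.dualMap]; rfl
      have e2 : ∀ z : R.dual.dual.carrier, TrivSqZeroExt.snd (InfAlg.dualMap R.pt z) =
          TrivSqZeroExt.fst (TrivSqZeroExt.snd z) := fun z => by simp [InfAlg.dualMap]; rfl
      refine TrivSqZeroExt.ext ((e1 _).trans ?_) ((e2 _).trans ?_)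
      · simp [hDf, InfAlg.scale]
      · rcases Letter.eq_or_eq_bar q i with rfl | rfl
        · simp [hDs, h4]
        · simp [hDs, h5, hC]
  have hl : X.linesMap R.pt (X.line V) = X.line w := congrArg X.line hV
  refine ⟨X.line V, ⟨w, TrivSqZeroExt.snd (C q), hl, v2⟩, hl, V, D, rfl, v3, hu, ?_, ?_⟩
  · rw [hDf]
    refine TrivSqZeroExt.ext ?_ ?_
    · simp [h3, hC, InfAlg.scale]
    · simp [h4, InfAlg.scale]
  · simp [hDs]

theorem prolong_ext (q : Letter) {R : InfAlg K} {v v' : X.prolong.obj R.dual}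
    {C : Letter → R.dual.carrier} (hv : v ∈ X.prolong.foc R) (hv' : v' ∈ X.prolong.foc R)
    (hf : X.prolong.foot v = X.prolong.foot v')
    (h : prolongAct act q (R := R.dual) v C) (h' : prolongAct act q (R := R.dual) v' C) :
    v = v' := by
  obtain ⟨w, c, h1, h2⟩ := hv
  obtain ⟨w', c', h1', h2'⟩ := hv'
  obtain ⟨a, ha⟩ := line_eq_line_iff.1 (h1.symm.trans (hf.trans h1'))
  rw [ha, smul_smul] at h2'
  have h3 := hc.prolong_map q R.pt h
  obtain ⟨Y, y1, y2, -, -⟩ := hc.of_line (w := w) (by rw [← h1]; exact h3)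
  obtain ⟨V, D, rfl, d1, d2, d3, d4⟩ := hc.normalForm h
  obtain ⟨V', D', rfl, d1', d2', d3', d4'⟩ := hc.normalForm h'
  change X.foot V.1 = _ at h2
  change X.foot V'.1 = _ at h2'
  have e := hc.act_foot d1
  have e' := hc.act_foot d1'
  -- Both projected vectors are multiples of `w`, and `dx_q(w)` is a unit, so their common `dx_q`
  -- fixes the factor.
  have hcc : c = c' * a := by
    have g := congrFun (hc.unique e (by rw [h2]; exact hc.act_smul y1 c)) q
    have g' := congrFun (hc.unique e' (by rw [h2']; exact hc.act_smul y1 (c' * a))) q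
    simp only [d2] at g
    simp only [d2'] at g'
    have g2 := congrArg TrivSqZeroExt.snd (g.symm.trans g')
    exact y2.mul_right_cancel (by simpa [InfAlg.scale] using g2)
  have hfoot : X.foot V.1 = X.foot V'.1 := by rw [h2, h2', hcc]
  have hDD : D = D' := by
    rw [hfoot] at e
    have g := hc.unique e e'
    funext i
    refine TrivSqZeroExt.ext (congrFun g i) ?_
    rcases Letter.eq_or_eq_bar q i with rfl | rfl
    · rw [d3, d3']
    · rw [d4, d4']
  subst hDD
  exact congrArg X.line (Subtype.ext (hc.ext V.2.1 V'.2.1 hfoot d1 d1'))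

theorem prolong (q : Letter) : X.prolong.IsChart (prolongAct act q) where
  smulClosed := SMulClosed.prolong X
  map := hc.prolong_map q
  unique := hc.prolong_unique q
  lift := hc.prolong_lift q
  ext := hc.prolong_ext q

end IsChart

/-! ### Local equations of the divisors at infinity and of prolonged loci. -/

/-- A locus which is stable under homomorphisms of coefficient algebras. -/
def Locus.Stable (Z : X.Locus) : Prop :=
  ∀ {R R' : InfAlg K} (f : InfAlg.Hom R R') (y : X.obj R), y ∈ Z R → X.map f y ∈ Z R'

theorem Locus.Stable.prolong {Z : X.Locus} (hZ : Z.Stable) : Z.prolong.Stable := by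
  rintro R R' f y ⟨w, hw, rfl⟩
  exact ⟨X.dirMap f w, hZ _ _ hw, rfl⟩

theorem zeroVec_map {R R' : InfAlg K} (f : InfAlg.Hom R R') (y : X.obj R) :
    X.map (InfAlg.dualMap f) (X.zeroVec y) = X.zeroVec (X.map f y) := by
  unfold zeroVec
  rw [X.map_comp, X.map_comp]
  refine X.map_congr (AlgHom.ext fun a => TrivSqZeroExt.ext ?_ ?_) y <;>
    simp [InfAlg.dualMap, InfAlg.const]

theorem atInfinity_stable (X : DistSpace.{u, v} K) : Locus.Stable (X.atInfinity) := by
  rintro R R' f y ⟨w, hw, rfl⟩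
  refine ⟨X.prolong.dirMap f w, ?_, rfl⟩
  have h : X.proj (X.prolong.dirMap f w).1 = X.map (InfAlg.dualMap f) (X.proj w.1) :=
    X.linesProj_map _ _
  unfold IsVertical at *
  rw [h, hw, zeroVec_map, foot_zeroVec]

namespace IsChart

variable {act : {R : InfAlg K} → X.obj R → (Letter → R.carrier) → Prop} (hc : X.IsChart act)
include hc

theorem proj_act {q : Letter} {R : InfAlg K} {y : X.prolong.obj R} {c : Letter → R.carrier}
    (h : prolongAct act q y c) : ∃ d, act (X.proj y) d ∧ d q = c q := by
  obtain ⟨w, Y, rfl, h2, -, h4, -⟩ := h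
  exact ⟨_, hc.act_foot h2, h4.symm⟩

/-- The local equation of the divisor at infinity. -/
theorem mem_atInfinity_iff {q q' : Letter} {R : InfAlg K} {y : X.prolong.prolong.obj R}
    {c : Letter → R.carrier} (h : prolongAct (X := X.prolong) (prolongAct act q) q' y c) :
    y ∈ X.atInfinity R ↔ q' = q.bar ∧ c q = 0 := by
  have hp := hc.prolong q
  constructor
  · rintro ⟨w, hw, rfl⟩
    obtain ⟨Y, h2, h3, h4, h5⟩ := hp.of_line h
    obtain ⟨d, d1, d2⟩ := hc.proj_act h2
    have h0 := hc.snd_eq_zero_of_eq_zeroVec d1 hw q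
    rw [d2] at h0
    rcases Letter.eq_or_eq_bar q q' with rfl | rfl
    · rw [h0] at h3
      exact absurd ((h3.map R.aug).ne_zero) (by simp)
    · refine ⟨rfl, ?_⟩
      rw [Letter.bar_bar, h0] at h5
      exact h3.mul_left_eq_zero.1 h5
  · rintro ⟨rfl, h0⟩
    obtain ⟨w, Y, rfl, h2, h3, h4, h5⟩ := h
    refine ⟨w, ?_, rfl⟩
    rw [Letter.bar_bar, h0, zero_mul] at h5
    -- The projection of `w` is `a` times a generator `v` of the line at its foot. Here `dx_q(v)` is
    -- a unit while `dx_q(w) = 0`, so `a = 0`.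
    obtain ⟨v, a, v1, v2⟩ := w.2.1
    obtain ⟨Z, z1, z2, -, -⟩ := hc.of_line (w := v) (by
      rw [← v1]; exact hc.prolong_map q R.pt h2)
    obtain ⟨d, d1, d2⟩ := hc.proj_act h2
    have hd : X.proj w.1 = X.smul a v.1 := v2
    have g := congrArg TrivSqZeroExt.snd
      (congrFun (hc.unique d1 (by rw [hd]; exact hc.act_smul z1 a)) q)
    rw [d2, ← h5] at g
    have ha : a = 0 := z2.mul_left_eq_zero.1 (by simpa [InfAlg.scale] using g.symm)
    unfold IsVertical
    rw [hd, ha, zero_smul, foot_zeroVec]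

/-- The necessary equation for the prolongation of a locus on which an active coordinate
vanishes. -/
theorem of_mem_prolong {q q' : Letter} {Z : X.Locus}
    (hZ : ∀ {R : InfAlg K} {y : X.obj R} {c : Letter → R.carrier}, act y c → y ∈ Z R → c q = 0)
    {R : InfAlg K} {y : X.prolong.obj R} {c : Letter → R.carrier} (h : prolongAct act q' y c)
    (hy : y ∈ Z.prolong R) : q' = q.bar ∧ c q = 0 := by
  obtain ⟨w, hw, rfl⟩ := hy
  obtain ⟨Y, h2, h3, h4, h5⟩ := hc.of_line h
  have h0 := congrArg TrivSqZeroExt.snd (hZ h2 hw)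
  rw [TrivSqZeroExt.snd_zero] at h0
  rcases Letter.eq_or_eq_bar q q' with rfl | rfl
  · rw [h0] at h3
    exact absurd ((h3.map R.aug).ne_zero) (by simp)
  · refine ⟨rfl, ?_⟩
    rw [Letter.bar_bar, h0] at h5
    exact h3.mul_left_eq_zero.1 h5

/-- Inductive description of the prolongations of a locus: if `Z` is cut out of the locus over `T`
by the vanishing of an active coordinate, the same is true for the prolongations. -/
theorem mem_prolong {q : Letter} {Z : X.Locus}
    (hZ : ∀ {R : InfAlg K} {y : X.obj R} {c : Letter → R.carrier}, act y c → y ∈ Z R → c q = 0)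
    (T : (R : InfAlg K) → Set (X.obj R.dual))
    (hT : ∀ {R : InfAlg K} (w : X.Dir R), X.foot w.1 ∈ Z R → w.1 ∈ T R)
    (hZT : ∀ {R : InfAlg K} {w : X.obj R.dual} {c : Letter → R.dual.carrier}, act w c → c q = 0 →
      w ∈ T R → w ∈ Z R.dual)
    {R : InfAlg K} {y : X.prolong.obj R} {c : Letter → R.carrier}
    (h : prolongAct act q.bar y c) (h0 : c q = 0) (hy : X.proj y ∈ Z R) : y ∈ Z.prolong R := by
  obtain ⟨w, Y, rfl, h2, h3, h4, h5⟩ := h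
  refine ⟨w, hZT h2 ?_ (hT w hy), rfl⟩
  refine TrivSqZeroExt.ext (hZ (hc.act_foot h2) hy) ?_
  rw [← Letter.bar_bar q, ← h5, Letter.bar_bar, h0, zero_mul, TrivSqZeroExt.snd_zero]

end IsChart

/-- A focal vector of the prolongation at a line tangent to `Z` is mapped to a tangent vector
of `Z`. -/
theorem Locus.Stable.proj_mem {Z : X.Locus} (hZ : Z.Stable) {R : InfAlg K}
    {w : X.prolong.obj R.dual} (hw : w ∈ X.prolong.foc R) (hf : X.prolong.foot w ∈ Z.prolong R) :
    X.proj w ∈ Z R.dual := by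
  obtain ⟨v, a, v1, v2⟩ := hw
  obtain ⟨v', h1, h2⟩ := hf
  obtain ⟨b, hb⟩ := line_eq_line_iff.1 (h2.symm.trans v1)
  have hd : X.proj w = X.smul a v.1 := v2
  rw [hd, hb, smul_smul]
  exact hZ _ _ h1

end DistSpace

/-! ### Charts, nodes and divisors in the monster tower. -/

section Tower

variable {K : Type u} [Field K] {U : Type v} (x : Letter → U → K)

open DistSpace

theorem coordSurface_isChart : (coordSurface x).IsChart (fun {_} y c => c = y.1.2) where
  smulClosed _ _ _ := trivial
  map f y c h := by
    subst h
    rfl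
  unique h h' := h.trans h'.symm
  lift := by
    rintro R ⟨⟨a, b⟩, hb⟩ c h C hC
    change c = b at h
    subst h
    refine ⟨⟨(a, C), fun i => ?_⟩, trivial, Subtype.ext (Prod.ext rfl (funext hC)), rfl⟩
    rw [← hb i]
    exact congrArg R.aug (hC i)
  ext := by
    rintro R ⟨⟨a, b⟩, hb⟩ ⟨⟨a', b'⟩, hb'⟩ C - - hf h h'
    have ha : a = a' := congrArg (fun z => z.1.1) hf
    exact Subtype.ext (Prod.ext ha (h.symm.trans h'))

/-- The symbols of `P` are the names of the charts of a sequence of prolongations. -/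
theorem monster_isChart (P : ℕ → Letter) : ∀ k : ℕ, (monster x k).IsChart
    (fun {R} y c => IsActive x k (fun i : Fin k => P i) (R := R) y c)
  | 0 => coordSurface_isChart x
  | k + 1 => (monster_isChart P k).prolong (P k)

theorem IsNode.isActive {x : Letter → U → K} {o : U} :
    ∀ {k : ℕ} {p : Fin k → Letter} {y : MonsterPt x k},
    IsNode x o k p y → IsActive x k p (R := InfAlg.ground K) y (fun _ => 0)
  | 0, _, _, h => h.2
  | _ + 1, _, _, h => h.2

theorem IsNode.existsUnique {o : U} (ho : ∀ i, x i o = 0) (P : ℕ → Letter) :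
    ∀ k : ℕ, ∃! y : MonsterPt x k, IsNode x o k (fun i : Fin k => P i) y
  | 0 => by
    refine ⟨⟨(o, fun _ => 0), fun i => (ho i).symm⟩, ⟨rfl, rfl⟩, ?_⟩
    rintro ⟨⟨a, b⟩, hb⟩ ⟨h1, h2⟩
    exact Subtype.ext (Prod.ext h1 h2.symm)
  | k + 1 => by
    obtain ⟨y, hy, hu⟩ := IsNode.existsUnique ho P k
    -- The next node is the line with differentials `dx_q = 1` and `dx_q̄ = 0`, where `q = P k`.
    have hc := monster_isChart x P k
    let C : Letter → (InfAlg.ground K).dual.carrier := fun i =>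
      ((0, if i = P k then 1 else 0) : K × K)
    have hCf : ∀ i, TrivSqZeroExt.fst (C i) = 0 := fun _ => rfl
    have hCs : ∀ i, TrivSqZeroExt.snd (C i) = if i = P k then 1 else 0 := fun _ => rfl
    have hq : TrivSqZeroExt.snd (C (P k)) = 1 := (hCs _).trans (if_pos rfl)
    have hq' : TrivSqZeroExt.snd (C (P k).bar) = 0 := (hCs _).trans (if_neg (Letter.bar_ne _))
    obtain ⟨w, w1, w2, w3⟩ := hc.lift hy.isActive C hCf
    have hunit : IsUnit (TrivSqZeroExt.snd (C (P k))) := by rw [hq]; exact isUnit_one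
    let W : (monster x k).Dir (InfAlg.ground K) := ⟨w, w1, hc.redVec_ne w3 hunit⟩
    refine ⟨(monster x k).line W, ⟨?_, W, C, rfl, w3, hunit, (hCf _).symm, ?_⟩, ?_⟩
    · have h : (monster x k).proj ((monster x k).line W) = y := w2
      rw [h]
      exact hy
    · exact (zero_mul _).trans hq'.symm
    · rintro y' ⟨h1, h2⟩
      obtain ⟨W', C', rfl, c2, c3, c4, c5⟩ := hc.normalForm (q := P k)
        (R := InfAlg.ground K) (y := y') (c := fun _ => 0) h2
      have hf : (monster x k).foot W'.1 = y := hu _ h1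
      have he : C' = C := by
        have e := hc.act_foot c2
        rw [hf] at e
        have g := hc.unique e hy.isActive
        funext i
        refine TrivSqZeroExt.ext (congrFun g i) ?_
        rcases Letter.eq_or_eq_bar (P k) i with h | h
        · rw [h, c4, hq]
        · rw [h, c5, hq']
      subst he
      exact congrArg (monster x k).line (Subtype.ext
        (hc.ext W'.2.1 w1 (hf.trans w2.symm) c2 w3))

theorem IsNode.truncPt {x : Letter → U → K} {o : U} (P : ℕ → Letter) {l k : ℕ} (h : l ≤ k)
    {y : MonsterPt x k} (hy : IsNode x o k (fun i : Fin k => P i) y) :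
    IsNode x o l (fun i : Fin l => P i) (truncPt x h y) := by
  induction k, h using Nat.le_induction with
  | base =>
    unfold _root_.truncPt
    rw [Nat.leRec_self]
    exact hy
  | succ k h ih =>
    have e : _root_.truncPt x (h.trans k.le_succ) y =
        _root_.truncPt x h ((monster x k).proj y) := by
      unfold _root_.truncPt
      rw [Nat.leRec_succ]
    rw [e]
    exact ih hy.1

theorem infDivisor_stable (m : ℕ) : ∀ n : ℕ, (infDivisor x m n).Stable
  | 0 => atInfinity_stable _
  | n + 1 => Locus.Stable.prolong (infDivisor_stable m n)

/-- The divisor at infinity and its prolongations only meet those charts whose names have a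
suitable block. -/
theorem of_mem_infDivisor (P : ℕ → Letter) (m : ℕ) : ∀ (n : ℕ) {R : InfAlg K}
    {y : (monster x (m + 2 + n)).obj R} {c : Letter → R.carrier},
    IsActive x (m + 2 + n) (fun i : Fin (m + 2 + n) => P i) y c → y ∈ infDivisor x m n R →
    (P m ≠ P (m + 1) ∧ ∀ i ≤ n, P (m + 1 + i) = P (m + 1)) ∧ c (P m) = 0
  | 0, R, y, c, h, hy => by
    obtain ⟨h1, h2⟩ := ((monster_isChart x P m).mem_atInfinity_iff
      (q := P m) (q' := P (m + 1)) h).1 hy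
    refine ⟨⟨?_, ?_⟩, h2⟩
    · rw [h1]
      exact (Letter.bar_ne _).symm
    · intro i hi
      rw [Nat.le_zero.1 hi]
  | n + 1, R, y, c, h, hy => by
    have hc := monster_isChart x P (m + 2 + n)
    obtain ⟨w, hw, rfl⟩ := id hy
    obtain ⟨Y, h2, -, -, -⟩ := hc.of_line (q := P (m + 2 + n)) h
    obtain ⟨⟨p1, p2⟩, -⟩ := of_mem_infDivisor P m n h2 hw
    obtain ⟨q1, q2⟩ := hc.of_mem_prolong (q := P m) (q' := P (m + 2 + n))
      (fun h hz => (of_mem_infDivisor P m n h hz).2) h hy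
    refine ⟨⟨p1, fun i hi => ?_⟩, q2⟩
    rcases Nat.lt_or_eq_of_le hi with hi | rfl
    · exact p2 i (by omega)
    · rw [Letter.eq_bar_of_ne p1.symm, ← q1]
      congr 1
      omega

/-- The equation `c (P m) = 0` suffices once the projection lies on the previous prolongation. The
induction runs over all coefficient algebras because tangency to a locus is membership of an
`R[ε]`-valued point. -/
theorem mem_infDivisor_succ (P : ℕ → Letter) (m : ℕ) : ∀ (n : ℕ),
    P m ≠ P (m + 1) → (∀ i ≤ n + 1, P (m + 1 + i) = P (m + 1)) → ∀ {R : InfAlg K}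
    {y : (monster x (m + 2 + n + 1)).obj R} {c : Letter → R.carrier},
    IsActive x (m + 2 + n + 1) (fun i : Fin (m + 2 + n + 1) => P i) y c → c (P m) = 0 →
    (monster x (m + 2 + n)).proj y ∈ infDivisor x m n R → y ∈ infDivisor x m (n + 1) R := by
  intro n p1 p2
  have hbar : P (m + 2 + n) = (P m).bar := by
    rw [← Letter.eq_bar_of_ne p1.symm, ← p2 (n + 1) le_rfl]
    congr 1
    omega
  induction n with
  | zero =>
    intro R y c h h0 hy
    refine (monster_isChart x P (m + 2)).mem_prolong (q := P m) (Z := (monster x m).atInfinity)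
      (fun h hz => (of_mem_infDivisor x P m 0 h hz).2) (fun _ => Set.univ) (fun _ _ => trivial)
      ?_ ?_ h0 hy
    · intro R w c h h0 _
      exact ((monster_isChart x P m).mem_atInfinity_iff (q := P m) (q' := P (m + 1)) h).2
        ⟨Letter.eq_bar_of_ne p1.symm, h0⟩
    · rw [← hbar]
      exact h
  | succ n ih =>
    intro R y c h h0 hy
    have p2' : ∀ i ≤ n + 1, P (m + 1 + i) = P (m + 1) := fun i hi => p2 i (by omega)
    have hbar' : P (m + 2 + n) = (P m).bar := by
      rw [← Letter.eq_bar_of_ne p1.symm, ← p2' (n + 1) le_rfl]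
      congr 1
      omega
    refine (monster_isChart x P (m + 2 + (n + 1))).mem_prolong (q := P m)
      (Z := infDivisor x m (n + 1))
      (fun h hz => (of_mem_infDivisor x P m (n + 1) h hz).2)
      -- Above the divisor itself the locus is not cut out by one equation: membership one level
      -- down is also needed. Focal vectors at lines tangent to the lower locus satisfy it by
      -- `Locus.Stable.proj_mem`.
      (fun R => {w | (monster x (m + 2 + n)).proj w ∈ infDivisor x m n R.dual})
      (fun w hw => Locus.Stable.proj_mem (infDivisor_stable x m n) w.2.1 hw)
      (fun h h0 hw => ih p2' hbar' h h0 hw) ?_ h0 hy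
    rw [← hbar]
    exact h

theorem IsNode.mem_infDivisor_iff {x : Letter → U → K} {o : U} (P : ℕ → Letter) (m n : ℕ)
    {y : MonsterPt x (m + 2 + n)} (hy : IsNode x o (m + 2 + n) (fun i : Fin (m + 2 + n) => P i) y) :
    y ∈ infDivisor x m n (InfAlg.ground K) ↔
      P m ≠ P (m + 1) ∧ ∀ i ≤ n, P (m + 1 + i) = P (m + 1) := by
  refine ⟨fun h => (of_mem_infDivisor x P m n hy.isActive h).1, ?_⟩
  rintro ⟨p1, p2⟩
  induction n with
  | zero =>
    exact ((monster_isChart x P m).mem_atInfinity_iff (q := P m) (q' := P (m + 1))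
      (R := InfAlg.ground K) (c := fun _ => 0) hy.isActive).2
      ⟨Letter.eq_bar_of_ne p1.symm, rfl⟩
  | succ n ih =>
    exact mem_infDivisor_succ x P m n p1 p2 hy.isActive rfl
      (ih hy.1 fun i hi => p2 i (by omega))

end Tower

/-! ## Code words and the block rule -/

/-- Minimality of the infimum amounts to a different letter at position `j - 1`, that is, at index
`j - 2`. This form is decidable, which settles the explicit example. -/
theorem blockBegin_eq_iff {k : ℕ} (p : Fin k → Letter) (i : Fin k) (j : ℕ) :
    blockBegin p i = j ↔ 1 ≤ j ∧ j ≤ (i : ℕ) + 1 ∧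
      (∀ l : Fin k, j ≤ (l : ℕ) + 1 → (l : ℕ) ≤ i → p l = p i) ∧
      ∀ l : Fin k, (l : ℕ) + 2 = j → p l ≠ p i := by
  have hne : ∃ j : ℕ, 1 ≤ j ∧ j ≤ (i : ℕ) + 1 ∧
      ∀ l : Fin k, j ≤ (l : ℕ) + 1 → (l : ℕ) ≤ i → p l = p i :=
    ⟨i + 1, by omega, le_rfl, fun l h h' => congrArg p (Fin.ext (by omega))⟩
  have hmem := Nat.sInf_mem hne
  change 1 ≤ blockBegin p i ∧ blockBegin p i ≤ (i : ℕ) + 1 ∧ ∀ l : Fin k,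
    blockBegin p i ≤ (l : ℕ) + 1 → (l : ℕ) ≤ i → p l = p i at hmem
  have hmin : ∀ j, 1 ≤ j → j ≤ (i : ℕ) + 1 →
      (∀ l : Fin k, j ≤ (l : ℕ) + 1 → (l : ℕ) ≤ i → p l = p i) → blockBegin p i ≤ j :=
    fun j h1 h2 h3 => Nat.sInf_le ⟨h1, h2, h3⟩
  constructor
  · rintro rfl
    refine ⟨hmem.1, hmem.2.1, hmem.2.2, fun l hl hp => ?_⟩
    have := hmin (l + 1) (by omega) (by omega) fun l' h h' => by
      rcases Nat.lt_or_ge l l' with h2 | h2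
      · exact hmem.2.2 l' (by omega) h'
      · rw [← hp]
        exact congrArg p (Fin.ext (by omega))
    omega
  · rintro ⟨h1, h2, h3, h4⟩
    refine le_antisymm (hmin j h1 h2 h3) (not_lt.1 fun hlt => ?_)
    have hi := i.2
    exact h4 ⟨j - 2, by omega⟩ (by simp only; omega)
      (hmem.2.2 _ (by simp only; omega) (by simp only; omega))

theorem blockWord_eq_V_iff {k : ℕ} (p : Fin k → Letter) (i : Fin k) (j : ℕ) :
    blockWord p i = .V j ↔ blockBegin p i = j ∧ 2 ≤ j := by
  have h := ((blockBegin_eq_iff p i _).1 rfl).1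
  unfold blockWord
  split_ifs with h1
  · simp only [false_iff]
    omega
  · simp only [CodeSymbol.V.injEq]
    omega

theorem blockWord_isCodeWord {k : ℕ} (p : Fin k → Letter) : IsCodeWord (blockWord p) := by
  refine ⟨fun i hi => ?_, fun i i' h => ?_⟩
  · have h := (blockBegin_eq_iff p i _).1 rfl
    exact if_pos (by omega)
  · right
    by_cases hp : p i' = p i
    · right
      have hb : blockBegin p i' = blockBegin p i := by
        obtain ⟨h1, h2, h3, h4⟩ := (blockBegin_eq_iff p i _).1 rfl
        refine (blockBegin_eq_iff p i' _).2 ⟨h1, by omega, fun l hl hl' => ?_, fun l hl => ?_⟩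
        · rcases Nat.lt_or_eq_of_le hl' with h5 | h5
          · rw [hp]
            exact h3 l hl (by omega)
          · exact congrArg p (Fin.ext h5)
        · rw [hp]
          exact h4 l hl
      unfold blockWord
      rw [hb]
    · left
      refine (blockWord_eq_V_iff p i' _).2 ⟨(blockBegin_eq_iff p i' _).2
        ⟨by omega, le_rfl, fun l hl hl' => congrArg p (Fin.ext (by omega)), fun l hl hl' => ?_⟩,
        by omega⟩
      obtain rfl : l = i := Fin.ext (by omega)
      exact hp hl'.symm

/-- `V j` can first arise only at position `j` and afterwards only by copying the prior symbol, so
its occurrences form a run starting at position `j`. -/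
theorem IsCodeWord.eq_V {k : ℕ} {A : Fin k → CodeSymbol} (hA : IsCodeWord A) {j : ℕ} :
    ∀ {n : ℕ} (hn : n < k), A ⟨n, hn⟩ = .V j →
      2 ≤ j ∧ j ≤ n + 1 ∧ ∀ l : Fin k, j ≤ (l : ℕ) + 1 → (l : ℕ) ≤ n → A l = .V j := by
  intro n
  induction n with
  | zero =>
    intro hn h
    rw [hA.1 _ rfl] at h
    cases h
  | succ n ih =>
    intro hn h
    rcases hA.2 ⟨n, by omega⟩ ⟨n + 1, hn⟩ rfl with h1 | h1 | h1
    · rw [h1] at h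
      cases h
    · have hj : n + 1 + 1 = j := by
        rw [h1] at h
        exact CodeSymbol.V.inj h
      refine ⟨by omega, by omega, fun l hl hl' => ?_⟩
      obtain rfl : l = ⟨n + 1, hn⟩ := Fin.ext (by simp only; omega)
      exact h
    · obtain ⟨h2, h3, h4⟩ := ih (by omega) (h1.symm.trans h)
      refine ⟨h2, by omega, fun l hl hl' => ?_⟩
      rcases Nat.lt_or_eq_of_le hl' with h5 | h5
      · exact h4 l hl (by omega)
      · obtain rfl : l = ⟨n + 1, hn⟩ := Fin.ext h5
        exact h

theorem IsCodeWord.numV_bounds {k : ℕ} {A : Fin k → CodeSymbol} (hA : IsCodeWord A) {j : ℕ}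
    {i : Fin k} (hi : A i = .V j) :
    (i : ℕ) + 2 ≤ numV A j + j ∧ numV A j + j ≤ k + 1 := by
  obtain ⟨h1, h2, h3⟩ := hA.eq_V i.2 hi
  constructor
  · have h : (Finset.Icc (⟨j - 1, by omega⟩ : Fin k) i).card ≤ numV A j := by
      refine Finset.card_le_card fun l hl => ?_
      rw [Finset.mem_Icc, Fin.le_def, Fin.le_def] at hl
      exact Finset.mem_filter.2 ⟨Finset.mem_univ _, h3 l (by simp only at hl; omega) hl.2⟩
    rw [Fin.card_Icc] at h
    simp only at h
    omega
  · have h : numV A j ≤ (Finset.Ici (⟨j - 1, by omega⟩ : Fin k)).card := by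
      refine Finset.card_le_card fun l hl => ?_
      have := (hA.eq_V l.2 (Finset.mem_filter.1 hl).2).2.1
      rw [Finset.mem_Ici, Fin.le_def]
      simp only
      omega
    rw [Fin.card_Ici] at h
    simp only at h
    omega

theorem IsCodeWord.codim_eq {k : ℕ} {A : Fin k → CodeSymbol} (hA : IsCodeWord A) :
    codim A = (Finset.univ.filter fun i => A i ≠ .R).card := by
  classical
  let f : CodeSymbol → ℕ := fun s => match s with
    | .R => 0
    | .V j => j
  rw [Finset.card_eq_sum_card_fiberwise (f := fun i => f (A i)) (t := Finset.Icc 2 k)]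
  · refine Finset.sum_congr rfl fun j hj => ?_
    unfold numV
    congr 1
    ext i
    have := Finset.mem_Icc.1 hj
    rcases h : A i with _ | j'
    · simp [h]
    · simp [h, f]
  · intro i hi
    have hi' : A i ≠ .R := (Finset.mem_filter.1 hi).2
    rcases h : A i with _ | j
    · exact absurd h hi'
    · obtain ⟨h1, h2, -⟩ := hA.eq_V i.2 h
      have := i.2
      simp only [h, f, Finset.coe_Icc, Set.mem_Icc]
      omega

/-! ### Intersection loci containing a node, and the node word. -/

section NodeWord

variable {K : Type u} [Field K] {U : Type v} {x : Letter → U → K} {o : U}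

theorem IsNode.mem_interLocus_iff (P : ℕ → Letter) {k : ℕ} {y : MonsterPt x k}
    (hy : IsNode x o k (fun i : Fin k => P i) y) (A : Fin k → CodeSymbol) :
    y ∈ interLocus x A ↔ ∀ m n : ℕ, m + 2 + n ≤ k → numV A (m + 2) = n + 1 →
      P m ≠ P (m + 1) ∧ ∀ i ≤ n, P (m + 1 + i) = P (m + 1) :=
  forall_congr' fun m => forall_congr' fun n => forall_congr' fun h => imp_congr_right fun _ =>
    (hy.truncPt P h).mem_infDivisor_iff P m n

theorem IsNode.mem_interLocus_blockWord (P : ℕ → Letter) {k : ℕ} {y : MonsterPt x k}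
    (hy : IsNode x o k (fun i : Fin k => P i) y) :
    y ∈ interLocus x (blockWord fun i : Fin k => P i) := by
  refine (hy.mem_interLocus_iff P _).2 fun m n hk hn => ?_
  have hb : ∃ i : Fin k, m + 1 + n ≤ i ∧ blockBegin (fun i : Fin k => P i) i = m + 2 := by
    -- Otherwise all `n + 1` occurrences would have one of the `n` indices from `m + 1` to `m + n`.
    by_contra! hcon
    have h : numV (blockWord fun i : Fin k => P i) (m + 2) ≤
        (Finset.Ico (m + 1) (m + 1 + n)).card := by
      refine Finset.card_le_card_of_injOn (fun i => (i : ℕ)) (fun i hi => ?_)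
        (fun i _ i' _ h => Fin.ext h)
      have hi := ((blockWord_eq_V_iff _ _ _).1 (Finset.mem_filter.1 hi).2).1
      have h1 := ((blockBegin_eq_iff _ _ _).1 hi).2.1
      have h2 : (i : ℕ) < m + 1 + n := not_le.1 fun h => hcon i h hi
      simp only [Finset.coe_Ico, Set.mem_Ico]
      omega
    rw [Nat.card_Ico] at h
    omega
  obtain ⟨i, hi, hib⟩ := hb
  obtain ⟨-, h2, h3, h4⟩ := (blockBegin_eq_iff _ _ _).1 hib
  have hik := i.2
  have e : ∀ l, m + 1 ≤ l → l ≤ i → P l = P i := fun l hl hl' =>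
    h3 ⟨l, by omega⟩ (by simp only; omega) hl'
  refine ⟨?_, fun l hl => ?_⟩
  · rw [e (m + 1) le_rfl (by omega)]
    exact h4 ⟨m, by omega⟩ rfl
  · rw [e (m + 1) le_rfl (by omega), e (m + 1 + l) (by omega) (by omega)]

theorem IsNode.eq_R_or_eq_blockWord (P : ℕ → Letter) {k : ℕ} {y : MonsterPt x k}
    (hy : IsNode x o k (fun i : Fin k => P i) y) {A : Fin k → CodeSymbol} (hA : IsCodeWord A)
    (hyA : y ∈ interLocus x A) (i : Fin k) :
    A i = .R ∨ A i = blockWord (fun i : Fin k => P i) i := by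
  rcases h : A i with _ | j
  · exact Or.inl rfl
  · right
    obtain ⟨h1, h2, -⟩ := hA.eq_V i.2 h
    obtain ⟨b1, b2⟩ := hA.numV_bounds h
    obtain ⟨m, rfl⟩ : ∃ m, j = m + 2 := ⟨j - 2, by omega⟩
    obtain ⟨n, hn⟩ : ∃ n, numV A (m + 2) = n + 1 := ⟨numV A (m + 2) - 1, by omega⟩
    obtain ⟨p1, p2⟩ := (hy.mem_interLocus_iff P A).1 hyA m n (by omega) hn
    -- By `numV_bounds` the run of `V (m + 2)` reaches index `i`, so the constancy given by the
    -- divisor covers all indices from `m + 1` to `i`.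
    have e : ∀ l, m + 1 ≤ l → l ≤ i → P l = P (m + 1) := fun l hl hl' => by
      have := p2 (l - (m + 1)) (by omega)
      rwa [Nat.add_sub_cancel' hl] at this
    refine ((blockWord_eq_V_iff _ _ _).2 ⟨(blockBegin_eq_iff _ _ _).2
      ⟨by omega, h2, fun l hl hl' => ?_, fun l hl => ?_⟩, h1⟩).symm
    · rw [e l (by omega) hl', e i (by omega) le_rfl]
    · rw [e i (by omega) le_rfl, show (l : ℕ) = m by omega]
      exact p1

theorem isNodeWord_iff_eq_blockWord (ho : ∀ i, x i o = 0) (P : ℕ → Letter) {k : ℕ}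
    (A : Fin k → CodeSymbol) :
    IsNodeWord x o (fun i : Fin k => P i) A ↔ A = blockWord fun i : Fin k => P i := by
  have hB := blockWord_isCodeWord fun i : Fin k => P i
  have hsub : ∀ {y : MonsterPt x k}, IsNode x o k (fun i : Fin k => P i) y →
      ∀ {A : Fin k → CodeSymbol}, IsCodeWord A → y ∈ interLocus x A →
      (Finset.univ.filter fun i => A i ≠ .R) ⊆
        Finset.univ.filter fun i => blockWord (fun i : Fin k => P i) i ≠ .R := by
    intro y hy A hA hyA i hi
    rw [Finset.mem_filter] at hi ⊢
    exact ⟨hi.1, ((hy.eq_R_or_eq_blockWord P hA hyA i).resolve_left hi.2) ▸ hi.2⟩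
  constructor
  · rintro ⟨hA, y, hy, hyA, hmax⟩
    -- The block word's locus contains the node, so it cannot be among the removed loci; hence `A`
    -- has as many symbols other than `R`, in the same places.
    have hle : codim (blockWord fun i : Fin k => P i) ≤ codim A :=
      not_lt.1 fun h => hmax _ hB h (hy.mem_interLocus_blockWord P)
    rw [hA.codim_eq, hB.codim_eq] at hle
    have heq := Finset.eq_of_subset_of_card_le (hsub hy hA hyA) hle
    funext i
    refine (hy.eq_R_or_eq_blockWord P hA hyA i).elim (fun h => ?_) id
    have h1 : i ∉ Finset.univ.filter fun i => A i ≠ .R := by simp [h]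
    rw [heq] at h1
    have h2 : blockWord (fun i : Fin k => P i) i = .R := by simpa using h1
    rw [h, h2]
  · rintro rfl
    obtain ⟨y, hy, -⟩ := IsNode.existsUnique x ho P k
    refine ⟨hB, y, hy, hy.mem_interLocus_blockWord P, fun A' hA' hlt hyA' => ?_⟩
    rw [hA'.codim_eq, hB.codim_eq] at hlt
    exact absurd (Finset.card_le_card (hsub hy hA' hyA')) (not_le.2 hlt)

end NodeWord

/-- With an infinite string, the prefixes naming the charts at all levels are restrictions of one
function; the letters beyond `k` are irrelevant. -/
theorem exists_nat_extension {k : ℕ} (p : Fin k → Letter) :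
    ∃ P : ℕ → Letter, p = fun i : Fin k => P i :=
  ⟨fun n => if h : n < k then p ⟨n, h⟩ else .one, funext fun i => by simp⟩

theorem theorem6p6 {K : Type u} [Field K] {U : Type v} (x : Letter → U → K) (o : U)
    (ho : ∀ i, x i o = 0) :
    (∀ (k : ℕ) (p : Fin k → Letter),
      (∃! y : MonsterPt x k, IsNode x o k p y) ∧
      ∀ A : Fin k → CodeSymbol, IsNodeWord x o p A ↔ A = blockWord p) ∧
    IsNodeWord x o
      ![Letter.two, .two, .two, .one, .two, .two, .one, .one, .two]
      ![CodeSymbol.R, .R, .R, .V 4, .V 5, .V 5, .V 7, .V 7, .V 9] := by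
  have main : ∀ (k : ℕ) (p : Fin k → Letter),
      (∃! y : MonsterPt x k, IsNode x o k p y) ∧
      ∀ A : Fin k → CodeSymbol, IsNodeWord x o p A ↔ A = blockWord p := by
    intro k p
    obtain ⟨P, rfl⟩ := exists_nat_extension p
    exact ⟨IsNode.existsUnique x ho P k, isNodeWord_iff_eq_blockWord ho P⟩
  refine ⟨main, ((main 9 _).2 _).2 (funext fun i => ?_)⟩
  have hb : blockBegin ![Letter.two, .two, .two, .one, .two, .two, .one, .one, .two] i =
      ![1, 1, 1, 4, 5, 5, 7, 7, 9] i := by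
    refine (blockBegin_eq_iff _ _ _).2 ?_
    revert i
    decide
  unfold blockWord
  rw [hb]
  clear hb
  revert i
  decide
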